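/- Let $d\ge 1$ and $n\ge 1$ be integers, let $X$ be a standard Borel space, and let $\mathbb{Z}^d$ act on $X$ by a free Borel action $a$. Let $G_a$ be the graph with vertex set $X$ in which $x$ and $y$ are adjacent if and only if $\gamma\cdot x=y$ for some $\gamma\in\mathbb{Z}^d$ with $|\gamma|_\infty=1$. For a finite set $F\subset X$ let $\partial F$ be the set of edges of $G_a$ with exactly one endpoint in $F$; put $\partial^1F=\partial F$, and let $\partial^{m+1}F$ be the set of edges of $G_a$ that belong to $\partial^mF$ or share a vertex with an edge in $\partial^mF$. Let $\partial_{\mathrm{vis}(\infty)}F$ be the set of edges $e\in\partial F$ such that the unique endpoint $x\notin F$ of $e$ lies in an infinite connected component of $G_a-\partial F$, the graph obtained from $G_a$ by removing the edges in $\partial F$. Let $[X]^{<\infty}$ be the set of all finite subsets of $X$; a set $C\subset[X]^{<\infty}$ is called Borel if for every $k$ the set $\{(x_1,\dots,x_k)\in X^k:\{x_1,\dots,x_k\}\in C\}$ is Borel in $X^k$. Then there is a Borel set $C\subset[X]^{<\infty}$ such that 1. $\bigcup C=X$; 2. for all distinct $R,S\in C$, the sets $\partial^nR$ and $\partial^nS$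 are disjoint; 3. every $S\in C$ is nonempty and connected (that is, the subgraph of $G_a$ induced on $S$ is connected), and $\partial S=\partial_{\mathrm{vis}(\infty)}S$. -/

import Mathlib

/-- The graph `G_a` of an action of `ℤ^d` on `X`: distinct points `x`, `y` are adjacent when
`γ · x = y` for some `γ ∈ ℤ^d` of sup norm `1`.  (The norm on `Fin d → ℤ` is the sup norm.  For a
free action the clause `x ≠ y` is automatic.) -/
def actionGraph (d : ℕ) (X : Type*) [AddAction (Fin d → ℤ) X] : SimpleGraph X where
  Adj x y := x ≠ y ∧ ∃ γ : Fin d → ℤ, ‖γ‖ = 1 ∧ γ +ᵥ x = y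
  symm := ⟨by
    rintro x y ⟨hxy, γ, hγ, rfl⟩
    exact ⟨hxy.symm, -γ, by rwa [norm_neg], neg_vadd_vadd γ x⟩⟩
  loopless := ⟨fun _ h => h.1 rfl⟩

/-- The edge boundary `∂F`: the edges incident on one vertex in `F` and one vertex not in `F`. -/
def edgeBoundary {V : Type*} (G : SimpleGraph V) (F : Set V) : Set (Sym2 V) :=
  {e | e ∈ G.edgeSet ∧ ∃ x ∈ F, ∃ y ∉ F, e = s(x, y)}

/-- The iterated boundary `∂ⁿF` for `n ≥ 1`: `∂¹F = ∂F`, and `∂ⁿ⁺¹F` consists of the edges that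
are in `∂ⁿF` or share a vertex with an edge in `∂ⁿF`.  The value at `n = 0` is a convention. -/
def iterEdgeBoundary {V : Type*} (G : SimpleGraph V) (F : Set V) : ℕ → Set (Sym2 V)
  | 0 => ∅
  | 1 => edgeBoundary G F
  | n + 2 => {e | e ∈ G.edgeSet ∧ (e ∈ iterEdgeBoundary G F (n + 1) ∨
      ∃ e' ∈ iterEdgeBoundary G F (n + 1), ∃ v, v ∈ e ∧ v ∈ e')}

/-- The part of the boundary of `F` that is visible from infinity: the edges `e ∈ ∂F` whose
endpoint `x ∉ F` lies in an infinite connected component of `G - ∂F`. -/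
def visibleBoundary {V : Type*} (G : SimpleGraph V) (F : Set V) : Set (Sym2 V) :=
  {e | e ∈ edgeBoundary G F ∧ ∃ x ∈ e, x ∉ F ∧
    ((G.deleteEdges (edgeBoundary G F)).connectedComponentMk x).supp.Infinite}

/-- Borel subsets of the space `[X]^{<∞}` of finite subsets of `X`: `C` is Borel when, for every
`n`, the set of tuples `(x₁, …, xₙ)` with `{x₁, …, xₙ} ∈ C` is Borel in `Xⁿ`.  (Mathlib's
σ-algebra on `Finset X` is a different one.) -/
def IsBorelFamily {X : Type*} [MeasurableSpace X] (C : Set (Finset X)) : Prop :=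
  ∀ n : ℕ, MeasurableSet {x : Fin n → X | ∃ S ∈ C, (S : Set X) = Set.range x}

/-! The sets are built in generations `k` with fast growing scales `r k`. `exists_centers` supplies
Borel, `10 * r k`-discrete sets `Z k` whose `2 * r k`-balls, over all `k`, cover `X`. It starts from
maximal discrete sets. Each point lies near a translate of the `k`-th one by `r k` times a vector
`c` from a fixed finite box, so by pigeonhole one `c` serves infinitely many `k`. Choosing the first
such `c` on each orbit in an invariant Borel way keeps the translated sets discrete.

A generation-`k` piece is the component of a center in the union of the `2 * r k`-balls and the `2 *
n`-neighbourhood of all earlier pieces. By induction the components of that neighbourhood are small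
compared with `r k` (`near_pieceBound`), so pieces stay bounded and those of one generation stay far
apart. If the `2 * n`-neighbourhood of an earlier piece meets a later piece, it is swallowed whole
(`thicken_piece_subset_of_lt`). Vertices of edges in `∂ⁿF` are within `n` of both `F` and its
complement, so in either case the `∂ⁿ` are disjoint.

Filling the holes of the pieces makes the whole boundary visible from infinity. It only removes
boundary edges, so disjointness survives. By freeness orbits are copies of `ℤ^d`, and Borelness
reduces to countable quantifiers. -/

/-- `y` can be reached from `x` by walking inside `P`. -/
def ConnIn {V : Type*} (G : SimpleGraph V) (P : Set V) : V → V → Prop :=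
  Relation.ReflTransGen fun a b => G.Adj a b ∧ a ∈ P ∧ b ∈ P

/-- `T` together with the finite components of its complement. -/
def fillHoles {V : Type*} (G : SimpleGraph V) (T : Set V) : Set V :=
  {y | {y' | ConnIn G Tᶜ y y'}.Finite}

/-! ### Walks inside a set and the filling of holes -/

section Graph

variable {V : Type*} {G : SimpleGraph V} {P Q T : Set V} {x y z : V}

theorem ConnIn.symm (h : ConnIn G P x y) : ConnIn G P y x := by
  induction h with
  | refl => exact .refl
  | tail _ hs ih => exact .head ⟨hs.1.symm, hs.2.2, hs.2.1⟩ ih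

theorem ConnIn.mono (hPQ : P ⊆ Q) (h : ConnIn G P x y) : ConnIn G Q x y := by
  induction h with
  | refl => exact .refl
  | tail _ hs ih => exact .tail ih ⟨hs.1, hPQ hs.2.1, hPQ hs.2.2⟩

theorem ConnIn.mem_of_ne (h : ConnIn G P x y) (hne : x ≠ y) : y ∈ P := by
  cases h with
  | refl => exact absurd rfl hne
  | tail _ hs => exact hs.2.2

theorem ConnIn.mem (h : ConnIn G P x y) (hx : x ∈ P) : y ∈ P := by
  by_cases hne : x = y
  · exact hne ▸ hx
  · exact h.mem_of_ne hne

theorem ConnIn.within_component (h : ConnIn G P x y) : ConnIn G {v | ConnIn G P x v} x y := by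
  induction h with
  | refl => exact .refl
  | tail h hs ih => exact .tail ih ⟨hs.1, h, .tail h hs⟩

/-- A point of `T` reaches only itself inside `Tᶜ`, since `ConnIn` is reflexive even off the set. -/
theorem subset_fillHoles : T ⊆ fillHoles G T := by
  intro y hy
  refine (Set.finite_singleton y).subset fun y' h => ?_
  by_contra hne
  exact (h.symm.mem_of_ne hne) hy

theorem mem_fillHoles_of_connIn_compl (h : ConnIn G Tᶜ x y) (hx : x ∈ fillHoles G T) :
    y ∈ fillHoles G T :=
  Set.Finite.subset hx fun _ h' => Relation.ReflTransGen.trans h h'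

/-- An edge from a hole to a point outside `T` stays in that hole, so edges leaving the filled set
start in `T`. -/
theorem edgeBoundary_fillHoles_subset :
    edgeBoundary G (fillHoles G T) ⊆ edgeBoundary G T := by
  rintro e ⟨he, x, hx, y, hy, rfl⟩
  have hyT : y ∉ T := fun h => hy (subset_fillHoles h)
  refine ⟨he, x, ?_, y, hyT, rfl⟩
  by_contra hxT
  exact hy (mem_fillHoles_of_connIn_compl (.single ⟨he, hxT, hyT⟩) hx)

/-- The outer endpoint has an infinite component in `Tᶜ`. That component misses the filled set, so
walks in it use no boundary edge. -/
theorem edgeBoundary_fillHoles_eq_visibleBoundary :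
    edgeBoundary G (fillHoles G T) = visibleBoundary G (fillHoles G T) := by
  refine Set.Subset.antisymm ?_ fun e he => he.1
  rintro e ⟨he, x, hx, y, hy, rfl⟩
  refine ⟨⟨he, x, hx, y, hy, rfl⟩, y, by simp, hy, ?_⟩
  refine Set.Infinite.mono ?_ hy
  intro v hv
  rw [SimpleGraph.ConnectedComponent.mem_supp_iff, SimpleGraph.ConnectedComponent.eq]
  refine SimpleGraph.Reachable.symm ?_
  rw [SimpleGraph.reachable_iff_reflTransGen]
  induction hv with
  | refl => exact .refl
  | @tail b c hb hs ih =>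
    refine .tail ih ?_
    have hb' : b ∉ fillHoles G T := fun h => hy (mem_fillHoles_of_connIn_compl (ConnIn.symm hb) h)
    have hc' : c ∉ fillHoles G T := fun h =>
      hy (mem_fillHoles_of_connIn_compl (ConnIn.symm (.tail hb hs)) h)
    rw [SimpleGraph.deleteEdges_adj]
    refine ⟨hs.1, ?_⟩
    rintro ⟨-, u, hu, w, -, huw⟩
    rcases Sym2.eq_iff.1 huw with ⟨rfl, -⟩ | ⟨-, rfl⟩
    · exact hb' hu
    · exact hc' hu

/-- A hole of `T` is adjacent to `T`, as the components of `G` are infinite. -/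
theorem exists_adj_of_mem_fillHoles
    (hG : ∀ x, {y | ConnIn G Set.univ x y}.Infinite)
    (hy : y ∈ fillHoles G T) : y ∈ T ∨ ∃ a b, ConnIn G Tᶜ y a ∧ G.Adj a b ∧ b ∈ T := by
  by_contra! hcon
  refine hG y (Set.Finite.subset hy ?_)
  intro v hv
  induction hv with
  | refl => exact .refl
  | @tail b c hb hs ih =>
    have hc : c ∉ T := hcon.2 b c ih hs.1
    exact .tail ih ⟨hs.1, ConnIn.mem ih hcon.1, hc⟩

/-- Every hole is connected and contains a neighbour of the connected set `T`. -/
theorem connected_induce_fillHoles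
    (hG : ∀ x, {y | ConnIn G Set.univ x y}.Infinite)
    (hz : z ∈ T) (hT : ∀ y ∈ T, ConnIn G T z y) :
    (G.induce (fillHoles G T)).Connected := by
  have key : ∀ y, ConnIn G (fillHoles G T) z y → ∀ hy : y ∈ fillHoles G T,
      (G.induce (fillHoles G T)).Reachable ⟨z, subset_fillHoles hz⟩ ⟨y, hy⟩ := by
    intro y h
    induction h with
    | refl => exact fun _ => .rfl
    | tail hb hs ih =>
      intro hy
      refine (ih hs.2.1).trans (SimpleGraph.Adj.reachable ?_)
      exact hs.1
  rw [SimpleGraph.connected_iff_exists_forall_reachable]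
  refine ⟨⟨z, subset_fillHoles hz⟩, fun ⟨y, hy⟩ => key y ?_ hy⟩
  rcases exists_adj_of_mem_fillHoles hG hy with hyT | ⟨a, b, hya, hab, hb⟩
  · exact (hT y hyT).mono subset_fillHoles
  · have h1 : ConnIn G (fillHoles G T) z b := (hT b hb).mono subset_fillHoles
    have h2 : ConnIn G (fillHoles G T) y a :=
      (ConnIn.within_component hya).mono fun v hv => mem_fillHoles_of_connIn_compl hv hy
    exact (h1.tail ⟨hab.symm, subset_fillHoles hb,
      mem_fillHoles_of_connIn_compl hya hy⟩).trans h2.symm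

/-- Every hole contains a neighbour of `T`, so local finiteness leaves finitely many holes, each
finite. -/
theorem finite_fillHoles
    (hG : ∀ x, {y | ConnIn G Set.univ x y}.Infinite)
    (hloc : ∀ x, {y | G.Adj x y}.Finite) (hT : T.Finite) : (fillHoles G T).Finite := by
  have hfin : (T ∪ ⋃ b ∈ T, ⋃ a ∈ {a | G.Adj b a ∧ a ∈ fillHoles G T},
      {y | ConnIn G Tᶜ a y}).Finite := by
    refine hT.union (hT.biUnion fun b _ => Set.Finite.biUnion ?_ fun a ha => ha.2)
    exact (hloc b).subset fun a ha => ha.1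
  refine hfin.subset fun y hy => ?_
  rcases exists_adj_of_mem_fillHoles hG hy with hyT | ⟨a, b, hya, hab, hb⟩
  · exact .inl hyT
  · refine .inr ?_
    simp only [Set.mem_iUnion]
    exact ⟨b, hb, a, ⟨hab.symm, mem_fillHoles_of_connIn_compl hya hy⟩, hya.symm⟩

/-- The iteration depends on `F` only through `∂F`; this transfers disjointness from pieces to
filled pieces. -/
theorem iterEdgeBoundary_mono {A B : Set V} (h : edgeBoundary G A ⊆ edgeBoundary G B) (n : ℕ) :
    iterEdgeBoundary G A n ⊆ iterEdgeBoundary G B n := by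
  induction n with
  | zero => exact subset_rfl
  | succ n ih =>
    cases n with
    | zero => exact h
    | succ n =>
      rintro e ⟨he, h | ⟨e', he', v, hv⟩⟩
      · exact ⟨he, .inl (ih h)⟩
      · exact ⟨he, .inr ⟨e', ih he', v, hv⟩⟩

end Graph

/-! ### The sup metric on orbits -/

/-- `x` and `y` are at distance at most `r` in the sup metric of their common orbit. -/
def Near {d : ℕ} {X : Type*} [AddAction (Fin d → ℤ) X] (r : ℕ) (x y : X) : Prop :=
  ∃ γ : Fin d → ℤ, (∀ i, |γ i| ≤ (r : ℤ)) ∧ γ +ᵥ x = y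

/-- The `r`-neighbourhood of `P`. -/
def thicken (d : ℕ) {X : Type*} [AddAction (Fin d → ℤ) X] (r : ℕ) (P : Set X) : Set X :=
  {y | ∃ x ∈ P, Near (d := d) r x y}

section Near

variable {d : ℕ} {X : Type*} [AddAction (Fin d → ℤ) X] {r s : ℕ} {x y z : X} {P : Set X}

theorem Near.refl (r : ℕ) (x : X) : Near (d := d) r x x :=
  ⟨0, by simp, zero_vadd _ _⟩

theorem Near.symm (h : Near (d := d) r x y) : Near (d := d) r y x := by
  obtain ⟨γ, hγ, rfl⟩ := h
  exact ⟨-γ, by simpa using hγ, neg_vadd_vadd γ x⟩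

theorem Near.trans (h : Near (d := d) r x y) (h' : Near (d := d) s y z) :
    Near (d := d) (r + s) x z := by
  obtain ⟨γ, hγ, rfl⟩ := h
  obtain ⟨η, hη, rfl⟩ := h'
  refine ⟨η + γ, fun i => ?_, add_vadd _ _ _⟩
  have := abs_add_le (η i) (γ i)
  have h1 := hγ i
  have h2 := hη i
  simp only [Pi.add_apply]
  push_cast
  lia

theorem Near.mono (hrs : r ≤ s) (h : Near (d := d) r x y) : Near (d := d) s x y := by
  obtain ⟨γ, hγ, rfl⟩ := h
  exact ⟨γ, fun i => (hγ i).trans (by exact_mod_cast hrs), rfl⟩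

theorem Near.vadd (h : Near (d := d) r x y) (γ : Fin d → ℤ) :
    Near (d := d) r (γ +ᵥ x) (γ +ᵥ y) := by
  obtain ⟨η, hη, rfl⟩ := h
  exact ⟨η, hη, by rw [← add_vadd, ← add_vadd, add_comm]⟩

/-- Translates of a `10 * r`-dense set by `r` times a fixed finite set are `r`-dense. -/
theorem exists_shift_near {r : ℕ} (hr : 0 < r) {x y : X} (h : Near (d := d) (10 * r) x y) :
    ∃ c : Fin d → ℤ, (∀ i, |c i| ≤ 10) ∧ Near (d := d) r ((r : ℤ) • c +ᵥ x) y := by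
  obtain ⟨γ, hγ, rfl⟩ := h
  have hr' : (0 : ℤ) < r := by exact_mod_cast hr
  refine ⟨fun i => γ i / r, fun i => ?_, fun i => γ i % r, fun i => ?_, ?_⟩
  · have := abs_le.1 (hγ i)
    push_cast at this
    rw [abs_le]
    constructor
    · rw [Int.le_ediv_iff_mul_le hr']; linarith
    · exact Int.ediv_le_of_le_mul hr' (by linarith)
  · rw [abs_of_nonneg (Int.emod_nonneg _ hr'.ne')]
    exact (Int.emod_lt_of_pos _ hr').le
  · rw [← add_vadd]
    congr 1
    ext i
    simp only [Pi.add_apply, Pi.smul_apply, smul_eq_mul]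
    exact Int.emod_add_mul_ediv _ _

theorem norm_le_natCast_iff (γ : Fin d → ℤ) (r : ℕ) :
    ‖γ‖ ≤ (r : ℝ) ↔ ∀ i, |γ i| ≤ (r : ℤ) := by
  rw [pi_norm_le_iff_of_nonneg (Nat.cast_nonneg r)]
  refine forall_congr' fun i => ?_
  rw [Int.norm_eq_abs]
  exact_mod_cast Iff.rfl

theorem near_one_of_adj (h : (actionGraph d X).Adj x y) : Near (d := d) 1 x y := by
  obtain ⟨-, γ, hγ, rfl⟩ := h
  exact ⟨γ, (norm_le_natCast_iff γ 1).1 (by simp [hγ]), rfl⟩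

theorem adj_of_near_one (h : Near (d := d) 1 x y) (hne : x ≠ y) : (actionGraph d X).Adj x y := by
  obtain ⟨γ, hγ, rfl⟩ := h
  refine ⟨hne, γ, le_antisymm ?_ ?_, rfl⟩
  · simpa using (norm_le_natCast_iff γ 1).2 hγ
  · by_contra hlt
    apply hne
    have : γ = 0 := by
      ext i
      have h1 := norm_le_pi_norm γ i
      rw [Int.norm_eq_abs] at h1
      have h2 : ((|γ i| : ℤ) : ℝ) < 1 := by push_cast; linarith [not_le.1 hlt]
      have h3 : |γ i| < 1 := by exact_mod_cast h2
      simpa using h3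
    rw [this, zero_vadd]

/-- Balls are connected. -/
theorem connIn_of_near (h : Near (d := d) r x y) (hP : ∀ v, Near (d := d) r x v → v ∈ P) :
    ConnIn (actionGraph d X) P x y := by
  induction r generalizing y with
  | zero =>
    obtain ⟨γ, hγ, rfl⟩ := h
    have : γ = 0 := by
      ext i
      simpa using hγ i
    rw [this, zero_vadd]
    exact .refl
  | succ r ih =>
    obtain ⟨γ, hγ, rfl⟩ := h
    -- Subtracting signs moves all nonzero coordinates one unit towards `0` at once, which is a
    -- single edge of the graph.
    have hstep : Near (d := d) r x ((fun i => γ i - (γ i).sign) +ᵥ x) := by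
      refine ⟨_, fun i => ?_, rfl⟩
      have := hγ i
      rcases lt_trichotomy (γ i) 0 with h | h | h
      · rw [Int.sign_eq_neg_one_of_neg h]; push_cast at this; rw [abs_le] at *; lia
      · simp [h]
      · rw [Int.sign_eq_one_of_pos h]; push_cast at this; rw [abs_le] at *; lia
    have hone : Near (d := d) 1 ((fun i => γ i - (γ i).sign) +ᵥ x) (γ +ᵥ x) := by
      refine ⟨fun i => (γ i).sign, fun i => ?_, ?_⟩
      · rcases lt_trichotomy (γ i) 0 with h | h | h
        · simp [Int.sign_eq_neg_one_of_neg h]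
        · simp [h]
        · simp [Int.sign_eq_one_of_pos h]
      · rw [← add_vadd]
        congr 1
        ext i
        simp
    have hc := ih hstep fun v hv => hP v (hv.mono (Nat.le_succ r))
    by_cases hne : (fun i => γ i - (γ i).sign) +ᵥ x = γ +ᵥ x
    · rwa [← hne]
    · exact hc.tail ⟨adj_of_near_one hone hne, hP _ (hstep.mono (Nat.le_succ r)), hP _ ⟨γ, hγ, rfl⟩⟩

theorem finite_setOf_near (r : ℕ) (x : X) : {y | Near (d := d) r x y}.Finite := by
  have : ((fun γ : Fin d → ℤ => γ +ᵥ x) '' {γ | ∀ i, |γ i| ≤ (r : ℤ)}).Finite := by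
    refine Set.Finite.image _ ((Set.finite_Icc (fun _ => -(r : ℤ)) (fun _ => (r : ℤ))).subset ?_)
    intro γ hγ
    exact ⟨fun i => (abs_le.1 (hγ i)).1, fun i => (abs_le.1 (hγ i)).2⟩
  refine this.subset ?_
  rintro y ⟨γ, hγ, rfl⟩
  exact ⟨γ, hγ, rfl⟩

theorem finite_setOf_adj (x : X) : {y | (actionGraph d X).Adj x y}.Finite :=
  (finite_setOf_near 1 x).subset fun _ h => near_one_of_adj h

theorem infinite_setOf_connIn_univ (hd : 1 ≤ d)
    (hfree : ∀ (γ : Fin d → ℤ) (x : X), γ +ᵥ x = x → γ = 0) (x : X) :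
    {y | ConnIn (actionGraph d X) Set.univ x y}.Infinite := by
  have hinj : Function.Injective fun m : ℕ => (fun _ => (m : ℤ) : Fin d → ℤ) +ᵥ x := by
    intro m m' h
    have h' : (-(fun _ => (m' : ℤ)) + (fun _ => (m : ℤ)) : Fin d → ℤ) +ᵥ x = x := by
      rw [add_vadd, neg_vadd_eq_iff]
      exact h
    have := congrFun (hfree _ _ h') ⟨0, hd⟩
    simp at this
    lia
  refine (Set.infinite_range_of_injective hinj).mono ?_
  rintro _ ⟨m, rfl⟩
  exact connIn_of_near (r := m) ⟨_, by simp, rfl⟩ fun _ _ => Set.mem_univ _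

/-- An edge of `∂F` has an endpoint on each side, and each further iteration moves by at most one
edge. -/
theorem near_of_mem_iterEdgeBoundary {F : Set X} {n : ℕ} {e : Sym2 X}
    (he : e ∈ iterEdgeBoundary (actionGraph d X) F n) {v : X} (hv : v ∈ e) :
    (∃ x ∈ F, Near (d := d) n v x) ∧ ∃ y ∉ F, Near (d := d) n v y := by
  induction n generalizing e v with
  | zero => exact he.elim
  | succ n ih =>
    cases n with
    | zero =>
      obtain ⟨he, x, hx, y, hy, rfl⟩ := he
      have h1 := near_one_of_adj (SimpleGraph.mem_edgeSet _ |>.1 he)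
      rcases Sym2.mem_iff.1 hv with rfl | rfl
      · exact ⟨⟨v, hx, .refl _ _⟩, y, hy, h1⟩
      · exact ⟨⟨x, hx, h1.symm⟩, v, hy, .refl _ _⟩
    | succ n =>
      obtain ⟨hG, he | ⟨e', he', u, hue, hue'⟩⟩ := he
      · obtain ⟨⟨x, hx, h⟩, y, hy, h'⟩ := ih he hv
        exact ⟨⟨x, hx, h.mono (Nat.le_succ _)⟩, y, hy, h'.mono (Nat.le_succ _)⟩
      · obtain ⟨⟨x, hx, h⟩, y, hy, h'⟩ := ih he' hue'
        have hvu : Near (d := d) 1 v u := by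
          by_cases hne : v = u
          · exact hne ▸ .refl _ _
          · rw [(Sym2.mem_and_mem_iff hne).1 ⟨hv, hue⟩] at hG
            exact near_one_of_adj (SimpleGraph.mem_edgeSet _ |>.1 hG)
        exact ⟨⟨x, hx, (hvu.trans h).mono (by lia)⟩, y, hy, (hvu.trans h').mono (by lia)⟩

theorem subset_thicken : P ⊆ thicken d r P := fun x hx => ⟨x, hx, .refl _ _⟩

theorem disjoint_iterEdgeBoundary_of_thicken_disjoint {A B : Set X} {n : ℕ}
    (h : Disjoint (thicken d (2 * n) A) B) :
    Disjoint (iterEdgeBoundary (actionGraph d X) A n)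
      (iterEdgeBoundary (actionGraph d X) B n) := by
  rw [Set.disjoint_left]
  intro e hA hB
  induction e with | _ u v =>
  obtain ⟨⟨x, hx, hux⟩, -⟩ := near_of_mem_iterEdgeBoundary hA (Sym2.mem_mk_left u v)
  obtain ⟨⟨y, hy, huy⟩, -⟩ := near_of_mem_iterEdgeBoundary hB (Sym2.mem_mk_left u v)
  exact Set.disjoint_left.1 h ⟨x, hx, (hux.symm.trans huy).mono (by lia)⟩ hy

theorem disjoint_iterEdgeBoundary_of_thicken_subset {A B : Set X} {n : ℕ}
    (h : thicken d (2 * n) A ⊆ B) :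
    Disjoint (iterEdgeBoundary (actionGraph d X) A n)
      (iterEdgeBoundary (actionGraph d X) B n) := by
  rw [Set.disjoint_left]
  intro e hA hB
  induction e with | _ u v =>
  obtain ⟨⟨x, hx, hux⟩, -⟩ := near_of_mem_iterEdgeBoundary hA (Sym2.mem_mk_left u v)
  obtain ⟨-, y, hy, huy⟩ := near_of_mem_iterEdgeBoundary hB (Sym2.mem_mk_left u v)
  exact hy (h ⟨x, hx, (hux.symm.trans huy).mono (by lia)⟩)

end Near

/-! ### Borel markers and centers -/

section Markers

variable {d : ℕ} {X : Type*} [MeasurableSpace X] [AddAction (Fin d → ℤ) X]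
  [MeasurableConstVAdd (Fin d → ℤ) X]

theorem measurable_vadd_mem {A : Set X} (hA : MeasurableSet A) (γ : Fin d → ℤ) :
    Measurable fun x => γ +ᵥ x ∈ A :=
  measurable_mem.2 (measurable_const_vadd γ hA)

/-- There are Borel maximal `R`-discrete sets. -/
theorem exists_markers [StandardBorelSpace X] (R : ℕ) : ∃ M : Set X, MeasurableSet M ∧
    (∀ x ∈ M, ∀ y ∈ M, Near (d := d) R x y → x = y) ∧ ∀ x, ∃ y ∈ M, Near (d := d) R x y := by
  obtain ⟨f, hf, hinj⟩ := MeasurableSpace.measurable_injection_nat_bool_of_countablySeparated X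
  have hfi : ∀ i, Measurable fun x => f x i := fun i => (measurable_pi_apply i).comp hf
  obtain ⟨e, he⟩ := exists_surjective_nat (Σ N : ℕ, (Fin N → Bool))
  -- Points whose first bits under `f` follow the `n`-th pattern, while no other point within `R`
  -- does. These countably many `R`-discrete sets cover `X`.
  let A : ℕ → Set X := fun n => {x | (∀ i : Fin (e n).1, f x i = (e n).2 i) ∧
    ∀ γ : Fin d → ℤ, (∀ i, |γ i| ≤ (R : ℤ)) → γ +ᵥ x ≠ x → ¬ ∀ i : Fin (e n).1, f (γ +ᵥ x) i = (e n).2 i}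
  have hpat : ∀ n, MeasurableSet {x | ∀ i : Fin (e n).1, f x i = (e n).2 i} := fun n =>
    measurableSet_setOfPred.2 <| .forall fun i =>
      measurableSet_setOfPred.1 (measurableSet_eq_fun (hfi _) measurable_const)
  have hA : ∀ n, MeasurableSet (A n) := by
    intro n
    refine measurableSet_setOfPred.2 <| .and (measurableSet_setOfPred.1 (hpat n)) <|
      .forall fun γ => .imp measurable_const <| .imp (.not ?_) (.not ?_)
    · exact measurableSet_setOfPred.1 (measurableSet_eq_fun (measurable_const_vadd γ) measurable_id)
    · exact measurable_vadd_mem (hpat n) γ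
  have hcov : ∀ x, ∃ n, x ∈ A n := by
    intro x
    have hsep : ∀ γ : Fin d → ℤ, ∃ m, γ +ᵥ x ≠ x → f (γ +ᵥ x) m ≠ f x m := by
      intro γ
      by_contra! hcon
      exact (hcon 0).1 (hinj (funext fun m => (hcon m).2))
    choose m hm using hsep
    have hfin : {γ : Fin d → ℤ | ∀ i, |γ i| ≤ (R : ℤ)}.Finite :=
      (Set.finite_Icc (fun _ => -(R : ℤ)) (fun _ => (R : ℤ))).subset fun γ hγ =>
        ⟨fun i => (abs_le.1 (hγ i)).1, fun i => (abs_le.1 (hγ i)).2⟩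
    obtain ⟨N, hN⟩ := (hfin.image m).bddAbove
    obtain ⟨n, hn⟩ := he ⟨N + 1, fun i => f x i⟩
    refine ⟨n, ?_⟩
    simp only [A, Set.mem_ofPred_eq]
    rw [hn]
    refine ⟨fun _ => rfl, fun γ hγ hne hall => hm γ hne ?_⟩
    exact hall ⟨m γ, Nat.lt_succ_of_le (hN ⟨γ, hγ, rfl⟩)⟩
  -- Greedy choice: a point of `A n` is added unless a point within `R` has already been taken.
  let U : ℕ → Set X := fun n => n.rec ∅ fun n V =>
    V ∪ {x | x ∈ A n ∧ ∀ γ : Fin d → ℤ, (∀ i, |γ i| ≤ (R : ℤ)) → γ +ᵥ x ∉ V}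
  have hU : ∀ n, MeasurableSet (U n) := by
    intro n
    induction n with
    | zero => exact .empty
    | succ n ih =>
      exact ih.union <| measurableSet_setOfPred.2 <| .and (measurable_mem.2 (hA n)) <|
        .forall fun γ => .imp measurable_const <| .not <| measurable_vadd_mem ih γ
  have hmono : Monotone U := monotone_nat_of_le_succ fun n => Set.subset_union_left
  have hdisc : ∀ n, ∀ x ∈ U n, ∀ y ∈ U n, Near (d := d) R x y → x = y := by
    intro n
    induction n with
    | zero => exact fun x hx => hx.elim
    | succ n ih =>
      rintro x (hx | hx) y (hy | hy) hxy
      · exact ih x hx y hy hxy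
      · obtain ⟨γ, hγ, rfl⟩ := hxy.symm
        exact absurd hx (hy.2 γ hγ)
      · obtain ⟨γ, hγ, rfl⟩ := hxy
        exact absurd hy (hx.2 γ hγ)
      · obtain ⟨γ, hγ, rfl⟩ := hxy
        by_contra hne
        exact hx.1.2 γ hγ (Ne.symm hne) hy.1.1
  refine ⟨⋃ n, U n, .iUnion hU, ?_, ?_⟩
  · intro x hx y hy
    obtain ⟨m, hm⟩ := Set.mem_iUnion.1 hx
    obtain ⟨n, hn⟩ := Set.mem_iUnion.1 hy
    exact hdisc _ x (hmono (le_max_left m n) hm) y (hmono (le_max_right m n) hn)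
  · intro x
    obtain ⟨n, hn⟩ := hcov x
    rcases Classical.em (∀ γ : Fin d → ℤ, (∀ i, |γ i| ≤ (R : ℤ)) → γ +ᵥ x ∉ U n) with h | h
    · exact ⟨x, Set.mem_iUnion.2 ⟨n + 1, .inr ⟨hn, h⟩⟩, .refl _ _⟩
    · push Not at h
      obtain ⟨γ, hγ, hU⟩ := h
      exact ⟨γ +ᵥ x, Set.mem_iUnion.2 ⟨n, hU⟩, γ, hγ, rfl⟩

/-- Given scales `r k` tending to infinity there are Borel sets `Z k` of centers, `Z k` being
`10 * r k`-discrete, such that every point is within `2 * r k` of `Z k` for some `k`. -/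
theorem exists_centers [StandardBorelSpace X] (r : ℕ → ℕ) (hr : ∀ k, k < r k) :
    ∃ Z : ℕ → Set X, (∀ k, MeasurableSet (Z k)) ∧
      (∀ k, ∀ x ∈ Z k, ∀ y ∈ Z k, Near (d := d) (10 * r k) x y → x = y) ∧
      ∀ x, ∃ k, ∃ z ∈ Z k, Near (d := d) (2 * r k) z x := by
  choose M hM hdisc hdense using fun k => exists_markers (d := d) (X := X) (10 * r k)
  obtain ⟨e, he⟩ := exists_injective_nat (Fin d → ℤ)
  let close (c : Fin d → ℤ) (k : ℕ) (x : X) : Prop :=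
    ∃ η : Fin d → ℤ, (∀ i, |η i| ≤ (r k : ℤ)) ∧ η +ᵥ ((r k : ℤ) • c +ᵥ x) ∈ M k
  -- The quantifier over `γ` makes this a property of the orbit.
  let good (c : Fin d → ℤ) (x : X) : Prop :=
    ∃ γ : Fin d → ℤ, ∀ N, ∃ k, N ≤ k ∧ close c k (γ +ᵥ x)
  let chosen (c : Fin d → ℤ) (x : X) : Prop := good c x ∧ ∀ c', e c' < e c → ¬ good c' x
  have hclose : ∀ (c : Fin d → ℤ) (k : ℕ) (γ : Fin d → ℤ), Measurable fun x => close c k (γ +ᵥ x) := by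
    intro c k γ
    refine .exists fun η => .and measurable_const ?_
    simp only [← add_vadd]
    exact measurable_vadd_mem (hM k) (η + ((r k : ℤ) • c + γ))
  have hgood : ∀ c, Measurable (good c) := fun c => .exists fun γ => .forall fun N =>
    .exists fun k => .and measurable_const (hclose c k γ)
  have hchosen : ∀ c, Measurable (chosen c) := fun c =>
    .and (hgood c) <| .forall fun c' => .imp measurable_const (hgood c').not
  have hgood_inv : ∀ (c γ : Fin d → ℤ) (x : X), good c (γ +ᵥ x) ↔ good c x := by
    refine fun c γ x => ⟨fun ⟨η, h⟩ => ⟨η + γ, ?_⟩, fun ⟨η, h⟩ => ⟨η - γ, ?_⟩⟩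
    · simpa only [add_vadd] using h
    · simpa only [← add_vadd, sub_add_cancel] using h
  have hchosen_inv : ∀ (c γ : Fin d → ℤ) (x : X), chosen c (γ +ᵥ x) ↔ chosen c x := fun c γ x => by
    simp only [chosen, hgood_inv]
  have huniq : ∀ c c' x, chosen c x → chosen c' x → c = c' := by
    intro c c' x h h'
    rcases lt_trichotomy (e c) (e c') with hlt | heq | hlt
    · exact absurd h.1 (h'.2 c hlt)
    · exact he heq
    · exact absurd h'.1 (h.2 c' hlt)
  have hexgood : ∀ x, ∃ c, good c x := by
    intro x
    have hsh : ∀ k, ∃ c : Fin d → ℤ, (∀ i, |c i| ≤ 10) ∧ close c k x := by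
      intro k
      obtain ⟨y, hy, hxy⟩ := hdense k x
      obtain ⟨c, hc, η, hη, rfl⟩ := exists_shift_near ((Nat.zero_le k).trans_lt (hr k)) hxy
      exact ⟨c, hc, η, hη, hy⟩
    choose c hc hck using hsh
    have hfin : {γ : Fin d → ℤ | ∀ i, |γ i| ≤ 10}.Finite :=
      (Set.finite_Icc (fun _ => -10) (fun _ => 10)).subset fun γ hγ =>
        ⟨fun i => (abs_le.1 (hγ i)).1, fun i => (abs_le.1 (hγ i)).2⟩
    have : Finite {γ : Fin d → ℤ | ∀ i, |γ i| ≤ 10} := hfin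
    -- Pigeonhole: the shifts for all scales lie in one finite box.
    obtain ⟨c₀, h₀⟩ := Finite.exists_infinite_fiber
      fun k => (⟨c k, hc k⟩ : {γ : Fin d → ℤ | ∀ i, |γ i| ≤ 10})
    refine ⟨c₀, 0, fun N => ?_⟩
    obtain ⟨k, hk, hN⟩ := (Set.infinite_coe_iff.1 h₀).exists_gt N
    refine ⟨k, hN.le, ?_⟩
    rw [zero_vadd]
    convert hck k
    rw [← show _ = c₀ from hk]
  have hexchosen : ∀ x, ∃ c, chosen c x := by
    intro x
    obtain ⟨c, hc, hmin⟩ := (InvImage.wf e Nat.lt_wfRel.wf).has_min {c | good c x} (hexgood x)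
    exact ⟨c, hc, fun c' hlt hg => hmin c' hg hlt⟩
  refine ⟨fun k => {z | ∃ c, chosen c z ∧ (r k : ℤ) • c +ᵥ z ∈ M k}, fun k => ?_, ?_, ?_⟩
  · exact measurableSet_setOfPred.2 <| .exists fun c =>
      .and (hchosen c) (measurable_vadd_mem (hM k) _)
  · rintro k x ⟨c, hc, hx⟩ y ⟨c', hc', hy⟩ hxy
    have hcy : chosen c y := by
      obtain ⟨γ, -, rfl⟩ := hxy
      exact (hchosen_inv c γ x).2 hc
    obtain rfl := huniq c c' y hcy hc'
    exact vadd_left_cancel _ (hdisc k _ hx _ hy (hxy.vadd _))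
  · intro x
    obtain ⟨c, hc⟩ := hexchosen x
    obtain ⟨γ, hγ⟩ := hc.1
    obtain ⟨N, hN⟩ : ∃ N : ℕ, ‖γ‖ ≤ N := exists_nat_ge _
    -- Taking `k` at least the norm of `γ` makes the detour from `x` to `γ +ᵥ x` shorter than `r k`;
    -- this is one of the two radii in `2 * r k`.
    obtain ⟨k, hk, η, hη, hm⟩ := hγ N
    refine ⟨k, (η + γ) +ᵥ x, ⟨c, (hchosen_inv c _ x).2 hc, ?_⟩, ?_⟩
    · convert hm using 1
      simp only [← add_vadd]
      congr 1
      abel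
    · have h1 : Near (d := d) (r k) x (γ +ᵥ x) :=
        Near.mono (hk.trans (hr k).le) ⟨γ, (norm_le_natCast_iff γ N).1 hN, rfl⟩
      have h2 : Near (d := d) (r k) (γ +ᵥ x) ((η + γ) +ᵥ x) := ⟨η, hη, by rw [add_vadd]⟩
      exact (h1.trans h2).symm.mono (by lia)

end Markers

/-! ### Construction and separation of the pieces -/

section Pieces

variable {d : ℕ} {X : Type*} [AddAction (Fin d → ℤ) X]

/-- The union of the first `k` generations of pieces: a piece of generation `k` consists of what
can be reached from a center in `Z k` by walking inside the `w`-neighbourhood of the earlier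
generations and the balls of radius `2 * r k` around the centers in `Z k`. -/
def earlierPieces (d : ℕ) {X : Type*} [AddAction (Fin d → ℤ) X] (Z : ℕ → Set X) (r : ℕ → ℕ)
    (w : ℕ) : ℕ → Set X
  | 0 => ∅
  | k + 1 => earlierPieces d Z r w k ∪ {x | ∃ z ∈ Z k, ConnIn (actionGraph d X)
      (thicken d w (earlierPieces d Z r w k) ∪ thicken d (2 * r k) (Z k)) z x}

/-- The set in which the pieces of generation `k` are components. -/
def pieceDomain (d : ℕ) {X : Type*} [AddAction (Fin d → ℤ) X] (Z : ℕ → Set X) (r : ℕ → ℕ)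
    (w k : ℕ) : Set X :=
  thicken d w (earlierPieces d Z r w k) ∪ thicken d (2 * r k) (Z k)

/-- The piece of generation `k` with center `z`. -/
def piece (d : ℕ) {X : Type*} [AddAction (Fin d → ℤ) X] (Z : ℕ → Set X) (r : ℕ → ℕ)
    (w k : ℕ) (z : X) : Set X :=
  {x | ConnIn (actionGraph d X) (pieceDomain d Z r w k) z x}

/-- Bounds for the diameters of the components of the `w`-neighbourhood of the first `k`
generations of pieces. -/
def pieceBound (w : ℕ) : ℕ → ℕ
  | 0 => 0
  | k + 1 => 4 * (pieceBound w k + w + k + 4) + 4 * pieceBound w k + 2 * w + 4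

/-- The scales used in the construction of the pieces. -/
def pieceScale (w k : ℕ) : ℕ := pieceBound w k + w + k + 4

/-- If the components of `N` are small and the balls around the centers in `Z` are far apart, then
a walk inside the union of `N` and these balls cannot get from one ball to another. -/
theorem near_of_connIn_of_near {N Z P : Set X} {δ ρ : ℕ}
    (hN : ∀ x y, ConnIn (actionGraph d X) N x y → Near (d := d) δ x y)
    (hZ : ∀ z ∈ Z, ∀ z' ∈ Z, Near (d := d) (2 * ρ + δ + 2) z z' → z = z')
    (hP : P ⊆ N ∪ thicken d ρ Z) {z v y : X} (hz : z ∈ Z) (hzv : Near (d := d) ρ z v)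
    (hvy : ConnIn (actionGraph d X) P v y) : Near (d := d) (ρ + 1 + δ) z y := by
  have inv : Near (d := d) ρ z y ∨
      ∃ u, Near (d := d) (ρ + 1) z u ∧ ConnIn (actionGraph d X) N u y := by
    induction hvy with
    | refl => exact .inl hzv
    | @tail b c _ hs ih =>
      have hbc := near_one_of_adj hs.1
      rcases ih with hb | ⟨u, hzu, hub⟩
      · exact .inr ⟨c, hb.trans hbc, .refl⟩
      · have hcP := hP hs.2.2
        by_cases hcN : c ∈ N
        · by_cases hbN : b ∈ N
          · exact .inr ⟨u, hzu, hub.tail ⟨hs.1, hbN, hcN⟩⟩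
          · have hub' : u = b := by
              by_contra hne
              exact hbN (hub.mem_of_ne hne)
            subst hub'
            rcases hP hs.2.1 with h | ⟨z', hz', hz'u⟩
            · exact absurd h hbN
            · obtain rfl := hZ z hz z' hz' ((hzu.trans hz'u.symm).mono (by lia))
              exact .inr ⟨c, hz'u.trans hbc, .refl⟩
        · obtain ⟨z', hz', hz'c⟩ := hcP.resolve_left hcN
          obtain rfl := hZ z hz z' hz'
            ((((hzu.trans (hN _ _ hub)).trans hbc).trans hz'c.symm).mono (by lia))
          exact .inl hz'c
  rcases inv with h | ⟨u, hzu, huy⟩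
  · exact h.mono (by lia)
  · exact hzu.trans (hN _ _ huy)

/-- The walk either stays in `N` or meets a ball; in the latter case both ends are within `ρ + 1 +
δ` of its center. -/
theorem near_of_connIn_union {N Z P : Set X} {δ ρ : ℕ}
    (hN : ∀ x y, ConnIn (actionGraph d X) N x y → Near (d := d) δ x y)
    (hZ : ∀ z ∈ Z, ∀ z' ∈ Z, Near (d := d) (2 * ρ + δ + 2) z z' → z = z')
    (hP : P ⊆ N ∪ thicken d ρ Z) {x y : X} (hxy : ConnIn (actionGraph d X) P x y) :
    Near (d := d) (2 * ρ + 2 * δ + 2) x y := by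
  have key : ConnIn (actionGraph d X) N x y ∨
      ∃ z ∈ Z, ∃ v, Near (d := d) ρ z v ∧ ConnIn (actionGraph d X) P x v := by
    induction hxy with
    | refl => exact .inl .refl
    | @tail b c hxb hs ih =>
      rcases ih with hb | h
      · rcases hP hs.2.1 with hbN | ⟨z, hz, hzb⟩
        · rcases hP hs.2.2 with hcN | ⟨z, hz, hzc⟩
          · exact .inl (hb.tail ⟨hs.1, hbN, hcN⟩)
          · exact .inr ⟨z, hz, c, hzc, .tail hxb hs⟩
        · exact .inr ⟨z, hz, b, hzb, hxb⟩
      · exact .inr h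
  rcases key with h | ⟨z, hz, v, hzv, hxv⟩
  · exact (hN _ _ h).mono (by lia)
  · have h1 := near_of_connIn_of_near hN hZ hP hz hzv hxv.symm
    have h2 := near_of_connIn_of_near hN hZ hP hz hzv (hxv.symm.trans hxy)
    exact (h1.symm.trans h2).mono (by lia)

variable {Z : ℕ → Set X} {w : ℕ}

/-- The diameter bound is a hypothesis here because the induction proving `near_pieceBound` needs
this estimate. -/
theorem near_of_mem_piece_of_bound {k : ℕ}
    (hZ : ∀ k, ∀ z ∈ Z k, ∀ z' ∈ Z k, Near (d := d) (10 * pieceScale w k) z z' → z = z')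
    (hN : ∀ x y, ConnIn (actionGraph d X) (thicken d w (earlierPieces d Z (pieceScale w) w k)) x y →
      Near (d := d) (pieceBound w k) x y) {z x : X} (hz : z ∈ Z k)
    (hx : x ∈ piece d Z (pieceScale w) w k z) :
    Near (d := d) (2 * pieceScale w k + 1 + pieceBound w k) z x := by
  refine near_of_connIn_of_near hN (fun z hz z' hz' h => hZ k z hz z' hz' (h.mono ?_))
    subset_rfl hz (.refl _ _) hx
  simp only [pieceScale]
  lia

theorem near_pieceBound
    (hZ : ∀ k, ∀ z ∈ Z k, ∀ z' ∈ Z k, Near (d := d) (10 * pieceScale w k) z z' → z = z')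
    (k : ℕ) : ∀ x y,
      ConnIn (actionGraph d X) (thicken d w (earlierPieces d Z (pieceScale w) w k)) x y →
      Near (d := d) (pieceBound w k) x y := by
  induction k with
  | zero =>
    intro x y h
    by_cases hne : x = y
    · exact hne ▸ .refl _ _
    · obtain ⟨_, h, -⟩ := h.mem_of_ne hne
      exact h.elim
  | succ k ih =>
    intro x y h
    -- This `ρ` is the radius of a ball containing the `w`-neighbourhood of a generation-`k` piece.
    refine (near_of_connIn_union (ρ := 2 * pieceScale w k + 1 + pieceBound w k + w) ih
      (fun z hz z' hz' h => hZ k z hz z' hz' (h.mono ?_)) ?_ h).mono ?_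
    · simp only [pieceScale]
      lia
    · rintro y ⟨x, hx | ⟨z, hz, hzx⟩, hxy⟩
      · exact .inl ⟨x, hx, hxy⟩
      · exact .inr ⟨z, hz, (near_of_mem_piece_of_bound hZ ih hz hzx).trans hxy⟩
    · simp only [pieceScale, pieceBound]
      lia

theorem near_of_mem_piece
    (hZ : ∀ k, ∀ z ∈ Z k, ∀ z' ∈ Z k, Near (d := d) (10 * pieceScale w k) z z' → z = z')
    {k : ℕ} {z x : X} (hz : z ∈ Z k) (hx : x ∈ piece d Z (pieceScale w) w k z) :
    Near (d := d) (2 * pieceScale w k + 1 + pieceBound w k) z x :=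
  near_of_mem_piece_of_bound hZ (near_pieceBound hZ k) hz hx

theorem eq_of_thicken_piece_inter
    (hZ : ∀ k, ∀ z ∈ Z k, ∀ z' ∈ Z k, Near (d := d) (10 * pieceScale w k) z z' → z = z')
    {k : ℕ} {z z' : X} (hz : z ∈ Z k) (hz' : z' ∈ Z k)
    (h : ¬ Disjoint (thicken d w (piece d Z (pieceScale w) w k z))
      (piece d Z (pieceScale w) w k z')) : z = z' := by
  obtain ⟨y, ⟨x, hx, hxy⟩, hy⟩ := Set.not_disjoint_iff.1 h
  refine hZ k z hz z' hz' ((((near_of_mem_piece hZ hz hx).trans hxy).trans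
    (near_of_mem_piece hZ hz' hy).symm).mono ?_)
  simp only [pieceScale]
  lia

variable {r : ℕ → ℕ}

theorem earlierPieces_mono : Monotone (earlierPieces d Z r w) :=
  monotone_nat_of_le_succ fun _ => Set.subset_union_left

theorem piece_subset_earlierPieces {j k : ℕ} (hjk : j < k) {z : X} (hz : z ∈ Z j) :
    piece d Z r w j z ⊆ earlierPieces d Z r w k := fun _ hx =>
  earlierPieces_mono (Nat.succ_le_of_lt hjk) (.inr ⟨z, hz, hx⟩)

/-- The neighbourhood of the earlier piece is a connected part of the later domain, so it lies in
any component it meets. -/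
theorem thicken_piece_subset_of_lt {j k : ℕ} (hjk : j < k) {z z' : X} (hz : z ∈ Z j)
    (h : ¬ Disjoint (thicken d w (piece d Z r w j z)) (piece d Z r w k z')) :
    thicken d w (piece d Z r w j z) ⊆ piece d Z r w k z' := by
  have hsub : thicken d w (piece d Z r w j z) ⊆ pieceDomain d Z r w k := by
    rintro y ⟨x, hx, hxy⟩
    exact .inl ⟨x, piece_subset_earlierPieces hjk hz hx, hxy⟩
  have hconn : ∀ y ∈ thicken d w (piece d Z r w j z),
      ConnIn (actionGraph d X) (pieceDomain d Z r w k) z y := by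
    rintro y ⟨x, hx, hxy⟩
    refine Relation.ReflTransGen.trans (b := x) ?_ ?_
    · exact (ConnIn.within_component hx).mono (subset_thicken.trans hsub)
    · exact connIn_of_near hxy fun v hv => hsub ⟨x, hx, hv⟩
  obtain ⟨y, hy, hy'⟩ := Set.not_disjoint_iff.1 h
  intro v hv
  exact (Relation.ReflTransGen.trans hy' (hconn y hy).symm).trans (hconn v hv)

theorem mem_piece_of_near {k : ℕ} {z x : X} (hz : z ∈ Z k) (h : Near (d := d) (2 * r k) z x) :
    x ∈ piece d Z r w k z :=
  connIn_of_near h fun _ hv => .inr ⟨z, hz, hv⟩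

theorem disjoint_iterEdgeBoundary_piece {n j k : ℕ}
    (hZ : ∀ k, ∀ z ∈ Z k, ∀ z' ∈ Z k, Near (d := d) (10 * pieceScale (2 * n) k) z z' → z = z')
    {z z' : X} (hz : z ∈ Z j) (hz' : z' ∈ Z k) (hjk : j ≤ k)
    (hne : piece d Z (pieceScale (2 * n)) (2 * n) j z ≠
      piece d Z (pieceScale (2 * n)) (2 * n) k z') :
    Disjoint (iterEdgeBoundary (actionGraph d X) (piece d Z (pieceScale (2 * n)) (2 * n) j z) n)
      (iterEdgeBoundary (actionGraph d X) (piece d Z (pieceScale (2 * n)) (2 * n) k z') n) := by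
  by_cases hdis : Disjoint (thicken d (2 * n) (piece d Z (pieceScale (2 * n)) (2 * n) j z))
      (piece d Z (pieceScale (2 * n)) (2 * n) k z')
  · exact disjoint_iterEdgeBoundary_of_thicken_disjoint hdis
  · rcases hjk.lt_or_eq with hlt | rfl
    · exact disjoint_iterEdgeBoundary_of_thicken_subset (thicken_piece_subset_of_lt hlt hz hdis)
    · rw [eq_of_thicken_piece_inter hZ hz hz' hdis] at hne
      exact absurd rfl hne

end Pieces

/-! ### Borelness of the construction -/

section Measurability

variable {d : ℕ} {X : Type*} [MeasurableSpace X] [AddAction (Fin d → ℤ) X]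
  [MeasurableConstVAdd (Fin d → ℤ) X]

theorem measurableSet_thicken (r : ℕ) {P : Set X} (hP : MeasurableSet P) :
    MeasurableSet (thicken d r P) := by
  have : thicken d r P = {y | ∃ γ : Fin d → ℤ, (∀ i, |γ i| ≤ (r : ℤ)) ∧ γ +ᵥ y ∈ P} := by
    ext y
    constructor
    · rintro ⟨x, hx, hxy⟩
      obtain ⟨γ, hγ, rfl⟩ := hxy.symm
      exact ⟨γ, hγ, hx⟩
    · rintro ⟨γ, hγ, h⟩
      exact ⟨_, h, Near.symm ⟨γ, hγ, rfl⟩⟩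
  rw [this]
  exact measurableSet_setOfPred.2 <| .exists fun γ => .and measurable_const <|
    measurable_vadd_mem hP γ

/-- Reachability is a countable union over the length of the path. -/
theorem measurable_reflTransGen {ι : Type*} [Countable ι] {q : X → ι → ι → Prop}
    (hq : ∀ a b, Measurable fun x => q x a b) (a b : ι) :
    Measurable fun x => Relation.ReflTransGen (q x) a b := by
  let S : ℕ → ι → X → Prop := fun n => n.rec (fun b _ => a = b) fun _ T b x => ∃ c, T c x ∧ q x c b
  have hS : ∀ n b, Measurable (S n b) := by
    intro n
    induction n with
    | zero => exact fun b => measurable_const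
    | succ n ih => exact fun b => .exists fun c => .and (ih c) (hq c b)
  have heq : (fun x => Relation.ReflTransGen (q x) a b) = fun x => ∃ n, S n b x := by
    ext x
    constructor
    · intro h
      induction h with
      | refl => exact ⟨0, rfl⟩
      | @tail b c _ hs ih =>
        obtain ⟨n, hn⟩ := ih
        exact ⟨n + 1, b, hn, hs⟩
    · rintro ⟨n, hn⟩
      induction n generalizing b with
      | zero => exact (show a = b from hn) ▸ .refl
      | succ n ih =>
        obtain ⟨c, hc, hcb⟩ := hn
        exact .tail (ih c hc) hcb
  rw [heq]
  exact .exists fun n => hS n b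

-- Freeness lifts walks in an orbit to `ℤ^d`, a countable index set not depending on `x`.
omit [MeasurableSpace X] [MeasurableConstVAdd (Fin d → ℤ) X] in
theorem connIn_vadd_iff (hfree : ∀ (γ : Fin d → ℤ) (x : X), γ +ᵥ x = x → γ = 0)
    (P : Set X) (x : X) (a b : Fin d → ℤ) :
    ConnIn (actionGraph d X) P (a +ᵥ x) (b +ᵥ x) ↔
      Relation.ReflTransGen (fun a b : Fin d → ℤ => ‖b - a‖ = 1 ∧ a +ᵥ x ∈ P ∧ b +ᵥ x ∈ P) a b := by
  have hinj : ∀ a b : Fin d → ℤ, a +ᵥ x = b +ᵥ x → a = b := by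
    intro a b h
    have : (a - b) +ᵥ (b +ᵥ x) = b +ᵥ x := by rw [← add_vadd, sub_add_cancel, h]
    exact sub_eq_zero.1 (hfree _ _ this)
  constructor
  · intro h
    have key : ∀ y, ConnIn (actionGraph d X) P (a +ᵥ x) y → ∃ b : Fin d → ℤ, b +ᵥ x = y ∧
        Relation.ReflTransGen
          (fun a b : Fin d → ℤ => ‖b - a‖ = 1 ∧ a +ᵥ x ∈ P ∧ b +ᵥ x ∈ P) a b := by
      intro y hy
      induction hy with
      | refl => exact ⟨a, rfl, .refl⟩
      | tail _ hs ih =>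
        obtain ⟨b, rfl, hb⟩ := ih
        obtain ⟨⟨-, γ, hγ, rfl⟩, h1, h2⟩ := hs
        refine ⟨γ + b, add_vadd _ _ _, hb.tail ⟨by simpa using hγ, h1, ?_⟩⟩
        rwa [add_vadd]
    obtain ⟨b', hb', hab⟩ := key _ h
    rwa [← hinj _ _ hb']
  · intro h
    induction h with
    | refl => exact .refl
    | @tail b c _ hs ih =>
      refine .tail ih ⟨⟨fun heq => ?_, c - b, hs.1, ?_⟩, hs.2⟩
      · have h1 := hs.1
        rw [hinj _ _ heq, sub_self, norm_zero] at h1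
        exact zero_ne_one h1
      · rw [← add_vadd, sub_add_cancel]

omit [MeasurableConstVAdd (Fin d → ℤ) X] in
/-- Connectedness inside a set `P x` that depends on `x` in a Borel way is a Borel condition. -/
theorem measurable_connIn (hfree : ∀ (γ : Fin d → ℤ) (x : X), γ +ᵥ x = x → γ = 0)
    {P : X → Set X} (hP : ∀ γ : Fin d → ℤ, Measurable fun x => γ +ᵥ x ∈ P x)
    (a b : Fin d → ℤ) :
    Measurable fun x => ConnIn (actionGraph d X) (P x) (a +ᵥ x) (b +ᵥ x) := by
  simp only [connIn_vadd_iff hfree]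
  exact measurable_reflTransGen (fun a b => .and measurable_const (.and (hP a) (hP b))) a b

omit [MeasurableSpace X] [MeasurableConstVAdd (Fin d → ℤ) X] in
theorem exists_vadd_eq_of_connIn {P : Set X} {x y : X} (h : ConnIn (actionGraph d X) P x y) :
    ∃ γ : Fin d → ℤ, γ +ᵥ x = y := by
  induction h with
  | refl => exact ⟨0, zero_vadd _ _⟩
  | tail _ hs ih =>
    obtain ⟨γ, rfl⟩ := ih
    obtain ⟨-, η, -, rfl⟩ := hs.1
    exact ⟨η + γ, add_vadd _ _ _⟩

theorem measurableSet_earlierPieces (hfree : ∀ (γ : Fin d → ℤ) (x : X), γ +ᵥ x = x → γ = 0)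
    {Z : ℕ → Set X} (hZ : ∀ k, MeasurableSet (Z k)) (r : ℕ → ℕ) (w k : ℕ) :
    MeasurableSet (earlierPieces d Z r w k) := by
  induction k with
  | zero => exact .empty
  | succ k ih =>
    refine ih.union ?_
    set P := thicken d w (earlierPieces d Z r w k) ∪ thicken d (2 * r k) (Z k)
    have hP : MeasurableSet P := (measurableSet_thicken w ih).union (measurableSet_thicken _ (hZ k))
    have : {x | ∃ z ∈ Z k, ConnIn (actionGraph d X) P z x} = {x | ∃ γ : Fin d → ℤ,
        γ +ᵥ x ∈ Z k ∧ ConnIn (actionGraph d X) P (γ +ᵥ x) ((0 : Fin d → ℤ) +ᵥ x)} := by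
      ext x
      constructor
      · rintro ⟨z, hz, h⟩
        obtain ⟨γ, rfl⟩ := exists_vadd_eq_of_connIn h.symm
        exact ⟨γ, hz, by rwa [zero_vadd]⟩
      · rintro ⟨γ, hz, h⟩
        rw [zero_vadd] at h
        exact ⟨_, hz, h⟩
    rw [this]
    exact measurableSet_setOfPred.2 <| .exists fun γ => .and (measurable_vadd_mem (hZ k) γ) <|
      measurable_connIn hfree (measurable_vadd_mem hP) γ 0

-- Finiteness is rewritten with quantifiers over countable types, as measurability requires.
omit [MeasurableSpace X] [MeasurableConstVAdd (Fin d → ℤ) X] in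
theorem vadd_mem_fillHoles_iff (T : Set X) (x : X) (a : Fin d → ℤ) :
    a +ᵥ x ∈ fillHoles (actionGraph d X) T ↔ ∃ F : Finset (Fin d → ℤ), ∀ b : Fin d → ℤ,
      ConnIn (actionGraph d X) Tᶜ (a +ᵥ x) (b +ᵥ x) → ∃ c ∈ F, c +ᵥ x = b +ᵥ x := by
  classical
  constructor
  · intro h
    have h' : {y | ConnIn (actionGraph d X) Tᶜ (a +ᵥ x) y}.Finite := h
    have hex : ∀ y : X, ∃ c : Fin d → ℤ,
        ConnIn (actionGraph d X) Tᶜ (a +ᵥ x) y → c +ᵥ x = y := by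
      intro y
      by_cases hy : ConnIn (actionGraph d X) Tᶜ (a +ᵥ x) y
      · obtain ⟨γ, rfl⟩ := exists_vadd_eq_of_connIn hy
        exact ⟨γ + a, fun _ => add_vadd _ _ _⟩
      · exact ⟨0, fun h => absurd h hy⟩
    choose c hc using hex
    exact ⟨h'.toFinset.image c, fun b hb =>
      ⟨c (b +ᵥ x), Finset.mem_image_of_mem _ (h'.mem_toFinset.2 hb), hc _ hb⟩⟩
  · rintro ⟨F, hF⟩
    refine (F.image fun c => c +ᵥ x).finite_toSet.subset ?_
    intro y hy
    obtain ⟨γ, rfl⟩ := exists_vadd_eq_of_connIn hy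
    rw [← add_vadd]
    obtain ⟨c, hc, heq⟩ := hF (γ + a) (by rw [add_vadd]; exact hy)
    rw [← heq]
    exact Finset.mem_coe.2 (Finset.mem_image_of_mem _ hc)

theorem measurable_mem_fillHoles [StandardBorelSpace X]
    (hfree : ∀ (γ : Fin d → ℤ) (x : X), γ +ᵥ x = x → γ = 0)
    {T : X → Set X} (hT : ∀ γ : Fin d → ℤ, Measurable fun x => γ +ᵥ x ∈ T x) (a : Fin d → ℤ) :
    Measurable fun x => a +ᵥ x ∈ fillHoles (actionGraph d X) (T x) := by
  simp only [vadd_mem_fillHoles_iff]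
  refine .exists fun F => .forall fun b => .imp
    (measurable_connIn hfree (fun γ => (hT γ).not) a b) <| .exists fun c => .and measurable_const ?_
  exact measurableSet_setOfPred.1
    (measurableSet_eq_fun (measurable_const_vadd c) (measurable_const_vadd b))

/-- The family of the pieces with their holes filled is Borel. -/
theorem isBorelFamily_filledPieces [StandardBorelSpace X]
    (hfree : ∀ (γ : Fin d → ℤ) (x : X), γ +ᵥ x = x → γ = 0)
    {Z : ℕ → Set X} (hZ : ∀ k, MeasurableSet (Z k)) (r : ℕ → ℕ) (w : ℕ)
    (hfin : ∀ k, ∀ z ∈ Z k, (fillHoles (actionGraph d X) (piece d Z r w k z)).Finite)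
    (hsub : ∀ k z, ∀ y ∈ fillHoles (actionGraph d X) (piece d Z r w k z),
      ∃ γ : Fin d → ℤ, γ +ᵥ z = y) :
    IsBorelFamily {S : Finset X | ∃ k, ∃ z ∈ Z k,
      (S : Set X) = fillHoles (actionGraph d X) (piece d Z r w k z)} := by
  have hP : ∀ k, MeasurableSet (pieceDomain d Z r w k) := fun k =>
    (measurableSet_thicken w (measurableSet_earlierPieces hfree hZ r w k)).union
      (measurableSet_thicken _ (hZ k))
  have hmem : ∀ (k : ℕ) (a : Fin d → ℤ), Measurable fun z =>
      a +ᵥ z ∈ fillHoles (actionGraph d X) (piece d Z r w k z) := by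
    intro k a
    refine measurable_mem_fillHoles hfree (fun γ => ?_) a
    have := measurable_connIn hfree (P := fun _ => pieceDomain d Z r w k)
      (measurable_vadd_mem (hP k)) 0 γ
    simp only [zero_vadd] at this
    exact this
  intro m
  -- A filled piece lies in the orbit of its center, so the center is `γ +ᵥ x i` for some `γ`, and
  -- membership is tested on translates of it.
  have heq : {x : Fin m → X | ∃ S ∈ {S : Finset X | ∃ k, ∃ z ∈ Z k,
      (S : Set X) = fillHoles (actionGraph d X) (piece d Z r w k z)}, (S : Set X) = Set.range x} =
      {x : Fin m → X | ∃ i : Fin m, ∃ (k : ℕ) (γ : Fin d → ℤ), γ +ᵥ x i ∈ Z k ∧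
        (∀ j, ∃ b : Fin d → ℤ, b +ᵥ (γ +ᵥ x i) = x j ∧
          b +ᵥ (γ +ᵥ x i) ∈ fillHoles (actionGraph d X) (piece d Z r w k (γ +ᵥ x i))) ∧
        ∀ b : Fin d → ℤ, b +ᵥ (γ +ᵥ x i) ∈
          fillHoles (actionGraph d X) (piece d Z r w k (γ +ᵥ x i)) →
          ∃ j, b +ᵥ (γ +ᵥ x i) = x j} := by
    ext x
    constructor
    · rintro ⟨S, ⟨k, z, hz, hS⟩, hx⟩
      rw [hS] at hx
      have hzT : z ∈ fillHoles (actionGraph d X) (piece d Z r w k z) := subset_fillHoles .refl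
      obtain ⟨i, hi⟩ := hx ▸ hzT
      refine ⟨i, k, 0, ?_⟩
      rw [zero_vadd, hi]
      refine ⟨hz, fun j => ?_, fun b hb => ?_⟩
      · have hj : x j ∈ fillHoles (actionGraph d X) (piece d Z r w k z) := hx ▸ ⟨j, rfl⟩
        obtain ⟨b, hb⟩ := hsub k z _ hj
        exact ⟨b, hb, hb ▸ hj⟩
      · rw [hx] at hb
        obtain ⟨j, hj⟩ := hb
        exact ⟨j, hj.symm⟩
    · rintro ⟨i, k, γ, hz, h1, h2⟩
      refine ⟨(hfin k _ hz).toFinset, ⟨k, _, hz, by simp⟩, ?_⟩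
      rw [Set.Finite.coe_toFinset]
      refine Set.Subset.antisymm (fun y hy => ?_) ?_
      · obtain ⟨b, rfl⟩ := hsub k _ y hy
        obtain ⟨j, hj⟩ := h2 b hy
        exact ⟨j, hj.symm⟩
      · rintro _ ⟨j, rfl⟩
        obtain ⟨b, hb, hb'⟩ := h1 j
        exact hb ▸ hb'
  rw [heq]
  have hcoord : ∀ (i : Fin m) (γ : Fin d → ℤ), Measurable fun x : Fin m → X => γ +ᵥ x i :=
    fun i γ => (measurable_const_vadd γ).comp (measurable_pi_apply i)
  have hE : ∀ (i j : Fin m) (γ b : Fin d → ℤ),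
      Measurable fun x : Fin m → X => b +ᵥ (γ +ᵥ x i) = x j := fun i j γ b =>
    measurableSet_setOfPred.1 <| measurableSet_eq_fun
      ((measurable_const_vadd b).comp (hcoord i γ)) (measurable_pi_apply j)
  have hF : ∀ (i : Fin m) (k : ℕ) (γ b : Fin d → ℤ), Measurable fun x : Fin m → X =>
      b +ᵥ (γ +ᵥ x i) ∈ fillHoles (actionGraph d X) (piece d Z r w k (γ +ᵥ x i)) :=
    fun i k γ b => (hmem k b).comp (hcoord i γ)
  exact measurableSet_setOfPred.2 <| .exists fun i => .exists fun k => .exists fun γ =>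
    .and (measurable_mem.2 (hcoord i γ (hZ k))) <| .and
      (.forall fun j => .exists fun b => .and (hE i j γ b) (hF i k γ b)) <|
      .forall fun b => .imp (hF i k γ b) <| .exists fun j => hE i j γ b

end Measurability

/-! ### The theorem -/

theorem theorem5p4 (d n : ℕ) (hd : 1 ≤ d) (hn : 0 < n)
    (X : Type*) [MeasurableSpace X] [StandardBorelSpace X]
    [AddAction (Fin d → ℤ) X] [MeasurableConstVAdd (Fin d → ℤ) X]
    (hfree : ∀ (γ : Fin d → ℤ) (x : X), γ +ᵥ x = x → γ = 0) :
    ∃ C : Set (Finset X),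
      IsBorelFamily C ∧
      (⋃ S ∈ C, (S : Set X)) = Set.univ ∧
      (∀ R ∈ C, ∀ S ∈ C, R ≠ S →
        Disjoint (iterEdgeBoundary (actionGraph d X) (R : Set X) n)
          (iterEdgeBoundary (actionGraph d X) (S : Set X) n)) ∧
      ∀ S ∈ C,
        ((actionGraph d X).induce (S : Set X)).Connected ∧
        edgeBoundary (actionGraph d X) (S : Set X) =
          visibleBoundary (actionGraph d X) (S : Set X) := by
  obtain ⟨Z, hZm, hZ, hcov⟩ := exists_centers (d := d) (X := X) (pieceScale (2 * n))
    fun k => by simp only [pieceScale]; lia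
  have hG := infinite_setOf_connIn_univ (X := X) hd hfree
  have hfin : ∀ k, ∀ z ∈ Z k, (fillHoles (actionGraph d X)
      (piece d Z (pieceScale (2 * n)) (2 * n) k z)).Finite := fun k z hz =>
    finite_fillHoles hG finite_setOf_adj
      ((finite_setOf_near _ z).subset fun x hx => near_of_mem_piece hZ hz hx)
  refine ⟨_, isBorelFamily_filledPieces hfree hZm (pieceScale (2 * n)) (2 * n) hfin ?_, ?_, ?_, ?_⟩
  · intro k z y hy
    rcases exists_adj_of_mem_fillHoles hG hy with hyT | ⟨a, b, hya, hab, hb⟩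
    · exact exists_vadd_eq_of_connIn hyT
    · exact exists_vadd_eq_of_connIn (P := Set.univ) <|
        ((ConnIn.mono (Set.subset_univ _) hb).tail ⟨hab.symm, trivial, trivial⟩).trans
          (hya.symm.mono (Set.subset_univ _))
  · refine Set.eq_univ_of_forall fun x => ?_
    obtain ⟨k, z, hz, hzx⟩ := hcov x
    simp only [Set.mem_iUnion]
    refine ⟨(hfin k z hz).toFinset, ⟨k, z, hz, by simp⟩, ?_⟩
    rw [Set.Finite.coe_toFinset]
    exact subset_fillHoles (mem_piece_of_near hz hzx)
  · rintro R ⟨j, z, hz, hR⟩ S ⟨k, z', hz', hS⟩ hne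
    -- Pieces with different indices may coincide, so distinctness is drawn from the filled sets,
    -- not from the indices.
    have hT : piece d Z (pieceScale (2 * n)) (2 * n) j z ≠
        piece d Z (pieceScale (2 * n)) (2 * n) k z' := by
      intro h
      rw [h, ← hS] at hR
      exact hne (Finset.coe_injective hR)
    rw [hR, hS]
    refine Disjoint.mono (iterEdgeBoundary_mono edgeBoundary_fillHoles_subset n)
      (iterEdgeBoundary_mono edgeBoundary_fillHoles_subset n) ?_
    rcases le_total j k with hjk | hkj
    · exact disjoint_iterEdgeBoundary_piece hZ hz hz' hjk hT
    · exact (disjoint_iterEdgeBoundary_piece hZ hz' hz hkj hT.symm).symm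
  · rintro S ⟨k, z, hz, hS⟩
    rw [hS]
    exact ⟨connected_induce_fillHoles hG (z := z) .refl fun y hy => ConnIn.within_component hy,
      edgeBoundary_fillHoles_eq_visibleBoundary⟩
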